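/- Let $V$ be a finite set of $v$ points and let $\mathcal{B}$ be a collection (repetitions allowed) of $k$-element subsets of $V$, called blocks. The pair $(V,\mathcal{B})$ is a $(v,k,\lambda)$-covering if any two distinct points of $V$ occur together in at least $\lambda$ blocks; it is symmetric if the number of blocks is $v$. Its excess is the loopless multigraph with vertex set $V$ in which distinct points $x$ and $y$ are joined by exactly $r_{xy}-\lambda$ edges, where $r_{xy}$ is the number of blocks containing both $x$ and $y$. A multigraph is $2$-regular if every vertex has degree $2$, counted with multiplicity; a pair of parallel edges is regarded as a cycle of length $2$. **Theorem.** Let $v$, $k$ and $\lambda$ be positive integers such that $k>\lambda+2$ and $v=\frac{k(k-1)-2}{\lambda}+1$. Let $p\equiv 3\pmod 4$ be a prime such that $p$ does not divide $\lambda$ and $p$ has odd multiplicity in the prime factorisation of $k-\lambda$. Then there does not exist a symmetric $(v,k,\lambda)$-covering with $2$-regular excess that contains an odd number of cycles with lengths divisible by $4$ and no cycle of length divisible by $2p$. -/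

import Mathlib

/-- A loopless multigraph with vertex set `V`, given by its edge multiplicities. -/
@[ext]
structure CovMultigraph (V : Type*) where
  /-- `mult x y` is the number of edges joining `x` and `y`. -/
  mult : V → V → ℕ
  symm : ∀ x y, mult x y = mult y x
  loopless : ∀ x, mult x x = 0

namespace CovMultigraph

variable {V : Type*}

/-- `H` is a subgraph of `G`. Vertices of `H` that lie on no edge of `H` play no role. -/
def IsSubgraph (H G : CovMultigraph V) : Prop :=
  ∀ x y, H.mult x y ≤ G.mult x y

/-- The degree of a vertex: the number of edges at `x`, counted with multiplicity. -/
def degree [Fintype V] (G : CovMultigraph V) (x : V) : ℕ :=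
  ∑ y, G.mult x y

/-- Every vertex has degree `m`. -/
def IsRegular [Fintype V] (G : CovMultigraph V) (m : ℕ) : Prop :=
  ∀ x, G.degree x = m

/-- The edges of `H` form a cycle of length `n ≥ 2`: there are distinct vertices
`f 0, …, f (n - 1)` such that the edges of `H`, with multiplicity, are exactly the `n` edges
joining `f i` and `f (i + 1)`, indices modulo `n` (`finRotate n` is `i ↦ i + 1` modulo `n`).
A cycle of length `2` is a pair of parallel edges. -/
def IsCycle [DecidableEq V] (H : CovMultigraph V) (n : ℕ) : Prop :=
  2 ≤ n ∧ ∃ f : Fin n → V, Function.Injective f ∧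
    ∀ x y, H.mult x y =
      (Finset.univ.filter fun i : Fin n => s(f i, f (finRotate n i)) = s(x, y)).card

/-- The set of cycles contained in `G` whose length is divisible by `d`. -/
def cyclesOfLengthDvd [DecidableEq V] (G : CovMultigraph V) (d : ℕ) : Set (CovMultigraph V) :=
  {H | H.IsSubgraph G ∧ ∃ n, d ∣ n ∧ H.IsCycle n}

end CovMultigraph

/-- A `(v, k, lam)`-covering with point set `V`: a collection of `k`-subsets of `V`, possibly
with repeated blocks, such that any two distinct points lie together in at least `lam` blocks. -/
structure PairCovering (V : Type*) [Fintype V] [DecidableEq V] (v k lam : ℕ) where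
  card_points : Fintype.card V = v
  blocks : Multiset (Finset V)
  card_block : ∀ B ∈ blocks, B.card = k
  covers : ∀ x y : V, x ≠ y → lam ≤ blocks.countP fun B => x ∈ B ∧ y ∈ B

namespace PairCovering

variable {V : Type*} [Fintype V] [DecidableEq V] {v k lam : ℕ}

/-- A covering is symmetric if it has as many blocks as points. -/
def IsSymmetric (C : PairCovering V v k lam) : Prop :=
  C.blocks.card = v

/-- The number of blocks containing both `x` and `y`. -/
def pairCount (C : PairCovering V v k lam) (x y : V) : ℕ :=
  C.blocks.countP fun B => x ∈ B ∧ y ∈ B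

/-- The excess of a covering: distinct points `x` and `y` are joined by `r - lam` edges, where
`r` is the number of blocks containing both. The subtraction does not truncate, by `covers`. -/
def excess (C : PairCovering V v k lam) : CovMultigraph V where
  mult x y := if x = y then 0 else C.pairCount x y - lam
  symm x y := by simp only [pairCount, eq_comm (a := x), and_comm (a := x ∈ _)]
  loopless x := by simp

end PairCovering

/-! Let `A` be the incidence matrix. Every point lies in exactly `k` blocks, so `A Aᵀ` is `(k - lam)
I`, plus `lam` times the all-ones matrix, plus the adjacency matrix `E` of the excess. On a cycle,
`E z = 0` says that entries two steps apart are opposite. Hence, where 2 is not a zero divisor, a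
cycle carries a plane of solutions if its length `n` is divisible by 4, and none otherwise. If there
are `t` cycles of the first kind, this gives `2t` orthogonal integer vectors, the rows of `g`, with
squared lengths `n / 2`, each occurring twice per cycle; these are prime to `p` because no cycle
length is divisible by `2p`. On them `A Aᵀ` is the scalar `k - lam = p ^ (2f + 1) * a` with `p ∤ a`,
and modulo `p` they span the kernel of `A Aᵀ` (`exists_eq_cycleMatrix_mulVec_of_ker`).

The parity of `t` comes from `even_card_of_gram`. Put `y = Aᵀ x` with `x = gᵀ s / p ^ f + m` and `g
m = 0`. Then `y ⬝ y' = p a (s ⬝ D s') + m ⬝ A Aᵀ m'`, where `D = g gᵀ`. The integral triples `(s, m,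
y)` reduce modulo `p` to a space of dimension at least `v`. Its projection to `(m, y)` is isotropic
for `m ⬝ A Aᵀ m' - y ⬝ y'` and meets the radical trivially. That radical contains the
`2t`-dimensional span of the rows of `g`, so the projection has dimension at most `v - t`. On its
kernel, of dimension at least `t`, both `m` and `y` are divisible by `p`; dividing the identity by
`p` gives `s ⬝ D s' ≡ 0`.

Thus `D = diag(c, c)`, nondegenerate modulo `p` with square determinant, has an isotropic subspace
of half its dimension. This makes `(-1) ^ t` a square modulo `p ≡ 3 (mod 4)`, so `t` is even. -/

open Matrix

/-! ### Isotropic subspaces and reduction modulo `p` -/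

/-- The kernel of an integer matrix reduces modulo `p` to a space of at least the expected
dimension. -/
theorem exists_reduction_of_ker (p : ℕ) [Fact p.Prime] {N m : Type*} [Fintype N] [Fintype m]
    (Q : (N → ℤ) →ₗ[ℤ] (m → ℤ)) :
    ∃ R : Submodule (ZMod p) (N → ZMod p),
      Fintype.card N ≤ Fintype.card m + Module.finrank (ZMod p) R ∧
      ∀ r ∈ R, ∃ z : N → ℤ, Q z = 0 ∧ r = fun i => (z i : ZMod p) := by
  classical
  let b := Module.finBasis ℤ (LinearMap.ker Q)
  let w : Fin (Module.finrank ℤ (LinearMap.ker Q)) → N → ZMod p :=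
    fun j i => (((b j : N → ℤ) i : ℤ) : ZMod p)
  have hw : LinearIndependent (ZMod p) w := by
    rw [Fintype.linearIndependent_iff]
    intro c hc
    choose d hd using fun j => ZMod.intCast_surjective (c j)
    have hdvd : ∀ i, (p : ℤ) ∣ ∑ j, d j * (b j : N → ℤ) i := by
      intro i
      rw [← ZMod.intCast_zmod_eq_zero_iff_dvd]
      have := congrFun hc i
      simp only [Finset.sum_apply, Pi.smul_apply, smul_eq_mul, Pi.zero_apply, w] at this
      push_cast
      simpa [hd] using this
    choose z' hz' using hdvd
    have hp0 : (p : ℤ) ≠ 0 := by exact_mod_cast (Fact.out : p.Prime).ne_zero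
    have hz : ((∑ j, d j • b j : LinearMap.ker Q) : N → ℤ) = (p : ℤ) • z' := by
      ext i
      simp [hz', Finset.sum_apply]
    -- The kernel is saturated: a kernel vector divisible by `p` has its quotient in the kernel.
    -- This keeps a basis independent modulo `p`.
    have hk : Q z' = 0 := by
      have h1 : Q ((p : ℤ) • z') = 0 := hz ▸ (∑ j, d j • b j : LinearMap.ker Q).2
      rw [map_smul] at h1
      exact (smul_eq_zero.mp h1).resolve_left hp0
    have heq : (∑ j, d j • b j) = (p : ℤ) • (⟨z', hk⟩ : LinearMap.ker Q) :=
      Subtype.ext (by simpa using hz)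
    intro j
    have := congrArg (fun x => b.repr x j) heq
    simp only [map_sum, map_smul, Module.Basis.repr_self, Finsupp.coe_finsetSum,
      Finset.sum_apply, Finsupp.smul_apply, Finsupp.single_apply, smul_eq_mul, mul_ite, mul_one,
      mul_zero, Finset.sum_ite_eq', Finset.mem_univ, if_true] at this
    rw [← hd j, this]
    simp
  refine ⟨Submodule.span _ (Set.range w), ?_, ?_⟩
  · rw [finrank_span_eq_card hw, Fintype.card_fin]
    have h1 := Submodule.finrank_quotient_add_finrank (LinearMap.ker Q)
    rw [Q.quotKerEquivRange.finrank_eq] at h1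
    have h2 := Submodule.finrank_le (LinearMap.range Q)
    rw [Module.finrank_fintype_fun_eq_card] at h1 h2
    omega
  · intro r hr
    obtain ⟨c, rfl⟩ := (Submodule.mem_span_range_iff_exists_fun _).1 hr
    choose d hd using fun j => ZMod.intCast_surjective (c j)
    refine ⟨((∑ j, d j • b j : LinearMap.ker Q) : N → ℤ), (∑ j, d j • b j : LinearMap.ker Q).2, ?_⟩
    ext i
    simp [w, hd, Finset.sum_apply]

theorem det_fromBlocks_zero_antidiagonal {F n : Type*} [CommRing F] [Fintype n] [DecidableEq n]
    (B C D : Matrix n n F) :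
    (fromBlocks 0 B C D).det = (-1) ^ Fintype.card n * (B.det * C.det) := by
  have h1 : (fromBlocks 0 1 1 0 : Matrix (n ⊕ n) (n ⊕ n) F).det = (-1) ^ Fintype.card n := by
    have : (fromBlocks 0 1 1 0 : Matrix (n ⊕ n) (n ⊕ n) F) * fromBlocks 1 0 1 1 =
        fromBlocks 1 1 1 0 := by simp [fromBlocks_multiply]
    have h2 := congrArg det this
    rw [det_mul, det_fromBlocks_zero₁₂, det_one, mul_one, mul_one, det_fromBlocks_one₁₁] at h2
    rw [h2]
    simp [det_neg]
  have : fromBlocks 0 B C D = fromBlocks B 0 D C * fromBlocks 0 1 1 0 := by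
    simp [fromBlocks_multiply]
  rw [this, det_mul, h1, det_fromBlocks_zero₁₂, mul_comm]

/-- A totally isotropic subspace of half the dimension forces the signed discriminant to be a
square. -/
theorem isSquare_neg_one_pow_of_isotropic {F E J : Type*} [Field F] [AddCommGroup E] [Module F E]
    [Fintype J] [DecidableEq J] (B : LinearMap.BilinForm F E) (hB : ∀ x y, B x y = B y x)
    (b : Module.Basis (J ⊕ J) F E) (hdet : IsSquare (LinearMap.BilinForm.toMatrix b B).det)
    (hdet0 : (LinearMap.BilinForm.toMatrix b B).det ≠ 0) (H : Submodule F E)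
    (hH : ∀ x ∈ H, ∀ y ∈ H, B x y = 0) (hdim : Module.finrank F H = Fintype.card J) :
    IsSquare ((-1 : F) ^ Fintype.card J) := by
  have : FiniteDimensional F E := b.finiteDimensional_of_finite
  obtain ⟨H', hc⟩ := H.exists_isCompl
  have hE : Module.finrank F E = Fintype.card J + Fintype.card J := by
    rw [Module.finrank_eq_card_basis b, Fintype.card_sum]
  have hdim' : Module.finrank F H' = Fintype.card J := by
    have := Submodule.finrank_add_eq_of_isCompl hc
    omega
  let e : Module.Basis (J ⊕ J) F E :=
    (((Module.finBasisOfFinrankEq F H hdim).reindex (Fintype.equivFin J).symm).prod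
      ((Module.finBasisOfFinrankEq F H' hdim').reindex (Fintype.equivFin J).symm)).map
      (Submodule.prodEquivOfIsCompl H H' hc)
  have he : ∀ j, e (Sum.inl j) ∈ H := by
    intro j
    simp [e]
  set G := LinearMap.BilinForm.toMatrix e B with hG
  -- In a basis whose first half spans `H`, isotropy kills the upper left block, so the determinant
  -- is `(-1) ^ |J|` times a square. Changing basis alters it only by a square.
  have hGb : G = fromBlocks 0 G.toBlocks₁₂ G.toBlocks₁₂ᵀ G.toBlocks₂₂ := by
    ext (i | i) (j | j)
    · simp [hG, LinearMap.BilinForm.toMatrix_apply, hH _ (he i) _ (he j)]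
    · simp [toBlocks₁₂]
    · simp [toBlocks₁₂, hG, LinearMap.BilinForm.toMatrix_apply, hB (e (Sum.inr i))]
    · simp [toBlocks₂₂]
  have h1 : G.det = (-1) ^ Fintype.card J * (G.toBlocks₁₂.det * G.toBlocks₁₂.det) := by
    conv_lhs => rw [hGb]
    rw [det_fromBlocks_zero_antidiagonal, det_transpose]
  have h2 : (b.toMatrix e).det * (b.toMatrix e).det * (LinearMap.BilinForm.toMatrix b B).det = G.det := by
    rw [hG, ← LinearMap.BilinForm.toMatrix_mul_basis_toMatrix b e B, det_mul, det_mul, det_transpose]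
    ring
  have hP : (b.toMatrix e).det ≠ 0 := by
    have := b.toMatrix_mul_toMatrix_flip e
    intro h0
    have h3 := congrArg det this
    rw [det_mul, h0, zero_mul, det_one] at h3
    exact zero_ne_one h3
  obtain ⟨d, hd⟩ := hdet
  have hne : G.toBlocks₁₂.det ≠ 0 := by
    intro h0
    rw [h1, h0, mul_zero, mul_zero] at h2
    exact mul_ne_zero (mul_ne_zero hP hP) hdet0 h2
  refine ⟨(b.toMatrix e).det * d / G.toBlocks₁₂.det, ?_⟩
  field_simp
  rw [hd] at h2
  linear_combination -h1 - h2

/-- A totally isotropic subspace meeting the radical of the form trivially. -/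
theorem two_mul_finrank_add_le_of_isotropic {F E : Type*} [Field F] [AddCommGroup E] [Module F E]
    [FiniteDimensional F E] (B : LinearMap.BilinForm F E) (hB : ∀ x y, B x y = B y x)
    (X Z : Submodule F E) (hX : ∀ x ∈ X, ∀ y ∈ X, B x y = 0) (hZ : ∀ z ∈ Z, ∀ y, B z y = 0)
    (hdis : ∀ x ∈ X, (∀ y, B x y = 0) → x = 0) :
    2 * Module.finrank F X + Module.finrank F Z ≤ Module.finrank F E := by
  have hrefl : B.IsRefl := fun x y h => by rw [hB, h]
  have h1 := LinearMap.BilinForm.finrank_add_finrank_orthogonal hrefl X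
  have h2 : X ⊓ B.orthogonal ⊤ = ⊥ := by
    rw [eq_bot_iff]
    rintro x ⟨hx, hx'⟩
    exact hdis x hx fun y => by rw [hB]; exact hx' y trivial
  have h3 : X ⊓ Z = ⊥ := by
    rw [eq_bot_iff]
    rintro x ⟨hx, hx'⟩
    exact hdis x hx (hZ x hx')
  -- As `X` misses the radical, its orthogonal has exact codimension `dim X`; it must contain the
  -- direct sum of `X` and `Z`.
  have h4 : X ⊔ Z ≤ B.orthogonal X := by
    refine sup_le (fun x hx y hy => hX y hy x hx) fun z hz y _ => ?_
    change B y z = 0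
    rw [hB, hZ z hz]
  have h5 := Submodule.finrank_mono h4
  have h6 := Submodule.finrank_sup_add_finrank_inf_eq X Z
  rw [h2, finrank_bot] at h1
  rw [h3, finrank_bot] at h6
  omega

/-- Compare the norms of both sides of `Aᵀ (gᵀ s + q m) = q y`. The span of the rows of `g` is
stable under `A Aᵀ` and orthogonal to `m`, so cross terms vanish and `q ^ 2` cancels. -/
theorem dotProduct_eq_of_gram {I V W : Type*} [Fintype I] [Fintype V] [Fintype W]
    (A : Matrix V W ℤ) (g : Matrix I V ℤ) (D : Matrix I I ℤ) (q b : ℤ) (hq : q ≠ 0)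
    (hg : g * gᵀ = D) (hAg : A * Aᵀ * gᵀ = (q * q * b) • gᵀ)
    {s s' : I → ℤ} {m m' : V → ℤ} {y y' : W → ℤ}
    (hy : Aᵀ *ᵥ (gᵀ *ᵥ s + q • m) = q • y) (hm : g *ᵥ m = 0)
    (hy' : Aᵀ *ᵥ (gᵀ *ᵥ s' + q • m') = q • y') (hm' : g *ᵥ m' = 0) :
    y ⬝ᵥ y' = b * (s ⬝ᵥ D *ᵥ s') + m ⬝ᵥ (A * Aᵀ) *ᵥ m' := by
  have hsym : ∀ x z : V → ℤ, x ⬝ᵥ (A * Aᵀ) *ᵥ z = ((A * Aᵀ) *ᵥ x) ⬝ᵥ z := by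
    intro x z
    rw [dotProduct_mulVec, ← mulVec_transpose]
    simp
  have hMg : ∀ s, (A * Aᵀ) *ᵥ (gᵀ *ᵥ s) = (q * q * b) • (gᵀ *ᵥ s) := by
    intro s
    rw [mulVec_mulVec, hAg, smul_mulVec]
  have hgm : ∀ (s : I → ℤ) (m : V → ℤ), (gᵀ *ᵥ s) ⬝ᵥ m = s ⬝ᵥ g *ᵥ m := by
    intro s m
    rw [dotProduct_mulVec, mulVec_transpose]
  have h1 : (q • y) ⬝ᵥ (q • y') =
      (gᵀ *ᵥ s + q • m) ⬝ᵥ (A * Aᵀ) *ᵥ (gᵀ *ᵥ s' + q • m') := by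
    rw [← hy, ← hy', ← mulVec_mulVec, dotProduct_mulVec _ A, ← mulVec_transpose]
  have h2 : (gᵀ *ᵥ s) ⬝ᵥ (gᵀ *ᵥ s') = s ⬝ᵥ D *ᵥ s' := by
    rw [hgm, mulVec_mulVec, hg]
  have h3 : (gᵀ *ᵥ s) ⬝ᵥ (A * Aᵀ) *ᵥ m' = 0 := by
    rw [hsym, hMg, smul_dotProduct, hgm, hm']
    simp
  have h4 : m ⬝ᵥ (gᵀ *ᵥ s') = 0 := by
    rw [dotProduct_comm, hgm, hm, dotProduct_zero]
  rw [mulVec_add, hMg, mulVec_smul] at h1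
  simp only [add_dotProduct, dotProduct_add, smul_dotProduct, dotProduct_smul, h2, h3, h4,
    smul_eq_mul] at h1
  have : q * q * (y ⬝ᵥ y') = q * q * (b * (s ⬝ᵥ D *ᵥ s') + m ⬝ᵥ (A * Aᵀ) *ᵥ m') := by
    linear_combination h1
  exact mul_left_cancel₀ (mul_ne_zero hq hq) this

/-- The form `diag(c, c)` over `ZMod p` with `p ≡ 3 [MOD 4]`: a large totally isotropic subspace
forces the length of `c` to be even. -/
theorem even_card_of_isotropic {p : ℕ} [Fact p.Prime] (hp4 : p % 4 = 3) {J : Type*} [Fintype J]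
    [DecidableEq J] (c : J → ZMod p) (hc : ∀ j, c j ≠ 0)
    (H : Submodule (ZMod p) (J ⊕ J → ZMod p)) (hH : Fintype.card J ≤ Module.finrank (ZMod p) H)
    (hiso : ∀ x ∈ H, ∀ y ∈ H, x ⬝ᵥ diagonal (Sum.elim c c) *ᵥ y = 0) :
    Even (Fintype.card J) := by
  set D : Matrix (J ⊕ J) (J ⊕ J) (ZMod p) := diagonal (Sum.elim c c) with hDdef
  have hdet : D.det = (∏ j, c j) * ∏ j, c j := by simp [hDdef, det_diagonal]
  have hdet0 : D.det ≠ 0 := by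
    rw [hdet]
    exact mul_ne_zero (Finset.prod_ne_zero_iff.2 fun j _ => hc j)
      (Finset.prod_ne_zero_iff.2 fun j _ => hc j)
  have hB : ∀ x y, toBilin' D x y = toBilin' D y x := by
    intro x y
    rw [toBilin'_apply', toBilin'_apply', dotProduct_mulVec, ← mulVec_transpose, hDdef,
      diagonal_transpose, dotProduct_comm]
  have hiso' : ∀ x ∈ H, ∀ y ∈ H, toBilin' D x y = 0 := fun x hx y hy => by
    rw [toBilin'_apply']; exact hiso x hx y hy
  have hle := two_mul_finrank_add_le_of_isotropic (toBilin' D) hB H ⊥ hiso'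
    (by intro z hz y; rw [(Submodule.mem_bot _).1 hz]; simp)
    (by
      intro x _ hx
      have h0 : D *ᵥ x = 0 := by
        ext i
        have := hx (Pi.single i 1)
        rw [hB, toBilin'_apply', single_one_dotProduct] at this
        exact this
      exact eq_zero_of_mulVec_eq_zero hdet0 h0)
  rw [finrank_bot, Module.finrank_fintype_fun_eq_card, Fintype.card_sum] at hle
  have hmat : LinearMap.BilinForm.toMatrix (Pi.basisFun (ZMod p) (J ⊕ J)) (toBilin' D) = D := by
    rw [LinearMap.BilinForm.toMatrix_basisFun]
    exact LinearMap.BilinForm.toMatrix'_toBilin' D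
  have hsq := isSquare_neg_one_pow_of_isotropic (toBilin' D) hB (Pi.basisFun (ZMod p) (J ⊕ J))
    (by rw [hmat]; exact ⟨_, hdet⟩) (by rw [hmat]; exact hdet0) H hiso' (by omega)
  by_contra hodd
  rw [Nat.not_even_iff_odd] at hodd
  rw [hodd.neg_one_pow, ZMod.exists_sq_eq_neg_one_iff] at hsq
  exact hsq hp4

theorem exists_eq_smul_of_cast_eq_zero {p : ℕ} {ι : Type*} (x : ι → ℤ)
    (hx : Int.castRingHom (ZMod p) ∘ x = 0) : ∃ x', x = (p : ℤ) • x' := by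
  have : ∀ i, (p : ℤ) ∣ x i := fun i =>
    (ZMod.intCast_zmod_eq_zero_iff_dvd _ _).1 (congrFun hx i)
  choose x' hx' using this
  exact ⟨x', funext hx'⟩

/-- If `A Aᵀ` acts on an orthogonal family of `2 |J|` vectors as an odd power of `p`, up to units,
and the family spans the kernel modulo `p ≡ 3 [MOD 4]`, then `|J|` is even. -/
theorem even_card_of_gram {p : ℕ} [Fact p.Prime] (hp4 : p % 4 = 3) {J V W : Type*} [Fintype J]
    [DecidableEq J] [Fintype V] [Fintype W] (hVW : Fintype.card W = Fintype.card V)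
    (A : Matrix V W ℤ) (f : ℕ) (a : ℤ) (ha : ¬ (p : ℤ) ∣ a) (c : J → ℤ)
    (hc : ∀ j, ¬ (p : ℤ) ∣ c j) (g : Matrix (J ⊕ J) V ℤ)
    (hg : g * gᵀ = diagonal (Sum.elim c c))
    (hAg : A * Aᵀ * gᵀ = ((p : ℤ) ^ (2 * f + 1) * a) • gᵀ)
    (hker : ∀ x : V → ZMod p, (A * Aᵀ).map (Int.cast : ℤ → ZMod p) *ᵥ x = 0 →
      ∃ s : J ⊕ J → ZMod p, x = (g.map (Int.cast : ℤ → ZMod p))ᵀ *ᵥ s) :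
    Even (Fintype.card J) := by
  classical
  have hp0 : (p : ℤ) ≠ 0 := by exact_mod_cast (Fact.out : p.Prime).ne_zero
  have hcast : ∀ n : ℤ, (n : ZMod p) ≠ 0 ↔ ¬ (p : ℤ) ∣ n := fun n => by
    rw [ne_eq, ZMod.intCast_zmod_eq_zero_iff_dvd]
  set q : ℤ := (p : ℤ) ^ f with hq
  have hq0 : q ≠ 0 := pow_ne_zero _ hp0
  have hqq : (p : ℤ) ^ (2 * f + 1) * a = q * q * (p * a) := by rw [hq]; ring
  rw [hqq] at hAg
  set D : Matrix (J ⊕ J) (J ⊕ J) ℤ := diagonal (Sum.elim c c) with hD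
  let φ := Int.castRingHom (ZMod p)
  -- The kernel of `Q` is the set of triples `(s, m, y)` with `Aᵀ (gᵀ s + q m) = q y` and `g m = 0`.
  -- There are `2|J| + |V| + |W|` unknowns and `|W| + 2|J|` equations, so the reduction `R` has
  -- dimension at least `|V|`.
  set Q : Matrix (W ⊕ (J ⊕ J)) ((J ⊕ J) ⊕ (V ⊕ W)) ℤ :=
    fromBlocks (Aᵀ * gᵀ) (fromCols (q • Aᵀ) ((-q) • 1)) 0 (fromCols g 0) with hQ
  obtain ⟨R, hRdim, hR⟩ := exists_reduction_of_ker p Q.mulVecLin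
  have hR' : ∀ r ∈ R, ∃ (s : J ⊕ J → ℤ) (m : V → ℤ) (y : W → ℤ),
      Aᵀ *ᵥ (gᵀ *ᵥ s + q • m) = q • y ∧ g *ᵥ m = 0 ∧
      r = Sum.elim (φ ∘ s) (Sum.elim (φ ∘ m) (φ ∘ y)) := by
    intro r hr
    obtain ⟨z, hz, rfl⟩ := hR r hr
    refine ⟨fun i => z (Sum.inl i), fun v => z (Sum.inr (Sum.inl v)),
      fun w => z (Sum.inr (Sum.inr w)), ?_, ?_, ?_⟩
    · have : ∀ w, (Q *ᵥ z) (Sum.inl w) = 0 := fun w => congrFun hz (Sum.inl w)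
      ext w
      have hw := this w
      simp only [hQ, fromBlocks_mulVec, Sum.elim_inl, fromCols_mulVec, Pi.add_apply,
        ← mulVec_mulVec, smul_mulVec, one_mulVec, Pi.smul_apply, smul_eq_mul] at hw
      simp only [mulVec_add, mulVec_smul, Pi.add_apply, Pi.smul_apply, smul_eq_mul]
      simp only [Function.comp_def] at hw
      linear_combination hw
    · ext i
      have hw : (Q *ᵥ z) (Sum.inr i) = 0 := congrFun hz (Sum.inr i)
      simpa [hQ, fromBlocks_mulVec, fromCols_mulVec, Function.comp_def] using hw
    · ext (i | v | w) <;> simp [φ]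
  have hid : ∀ {s s' : J ⊕ J → ℤ} {m m' : V → ℤ} {y y' : W → ℤ},
      Aᵀ *ᵥ (gᵀ *ᵥ s + q • m) = q • y → g *ᵥ m = 0 →
      Aᵀ *ᵥ (gᵀ *ᵥ s' + q • m') = q • y' → g *ᵥ m' = 0 →
      y ⬝ᵥ y' = p * a * (s ⬝ᵥ D *ᵥ s') + m ⬝ᵥ (A * Aᵀ) *ᵥ m' := by
    intro s s' m m' y y' h1 h2 h3 h4
    exact dotProduct_eq_of_gram A g D q _ hq0 hg hAg h1 h2 h3 h4
  set Mp : Matrix V V (ZMod p) := (A * Aᵀ).map φ with hMp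
  set gp : Matrix (J ⊕ J) V (ZMod p) := g.map φ with hgp
  set Dp : Matrix (J ⊕ J) (J ⊕ J) (ZMod p) := diagonal (Sum.elim (φ ∘ c) (φ ∘ c)) with hDp
  have hDmap : D.map φ = Dp := by
    rw [hD, hDp, diagonal_map (map_zero φ)]
    congr 1
    ext (j | j) <;> rfl
  have hggp : gp * gpᵀ = Dp := by
    rw [hgp, ← transpose_map, ← Matrix.map_mul, hg, hDmap]
  have hMg : Mp * gpᵀ = 0 := by
    rw [hMp, hgp, ← transpose_map, ← Matrix.map_mul, hAg]
    ext i j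
    simp [φ]
  have hDinj : ∀ s, Dp *ᵥ s = 0 → s = 0 := by
    intro s hs
    refine eq_zero_of_mulVec_eq_zero ?_ hs
    rw [hDp, det_diagonal, Fintype.prod_sum_type]
    exact mul_ne_zero (Finset.prod_ne_zero_iff.2 fun j _ => (hcast _).2 (hc j))
      (Finset.prod_ne_zero_iff.2 fun j _ => (hcast _).2 (hc j))
  have hMsymm : Mpᵀ = Mp := by rw [hMp, ← transpose_map, transpose_mul, transpose_transpose]
  have hMdot : ∀ m m' : V → ℤ, φ (m ⬝ᵥ (A * Aᵀ) *ᵥ m') = (φ ∘ m) ⬝ᵥ Mp *ᵥ (φ ∘ m') := by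
    intro m m'
    rw [RingHom.map_dotProduct]
    congr 1
    ext i
    exact RingHom.map_mulVec φ _ m' i
  have hDdot : ∀ s s' : J ⊕ J → ℤ, φ (s ⬝ᵥ D *ᵥ s') = (φ ∘ s) ⬝ᵥ Dp *ᵥ (φ ∘ s') := by
    intro s s'
    rw [RingHom.map_dotProduct, ← hDmap]
    congr 1
    ext i
    exact RingHom.map_mulVec φ _ s' i
  let π := (LinearMap.funLeft (ZMod p) (ZMod p) (Sum.inr : V ⊕ W → (J ⊕ J) ⊕ (V ⊕ W))).domRestrict R
  let ψ := (LinearMap.funLeft (ZMod p) (ZMod p) (Sum.inl : J ⊕ J → (J ⊕ J) ⊕ (V ⊕ W))).comp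
    (R.subtype.comp (LinearMap.ker π).subtype)
  have hψ : Function.Injective ψ := by
    rintro ⟨⟨r, hr⟩, hπ⟩ ⟨⟨r', hr'⟩, hπ'⟩ h
    refine Subtype.ext (Subtype.ext (funext ?_))
    rintro (i | i)
    · exact congrFun h i
    · exact congrFun (hπ.trans hπ'.symm) i
  have hψiso : ∀ x ∈ LinearMap.range ψ, ∀ y ∈ LinearMap.range ψ, x ⬝ᵥ Dp *ᵥ y = 0 := by
    rintro _ ⟨⟨⟨r, hr⟩, hπ⟩, rfl⟩ _ ⟨⟨⟨r', hr'⟩, hπ'⟩, rfl⟩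
    obtain ⟨s, m, y, h1, h2, rfl⟩ := hR' r hr
    obtain ⟨s', m', y', h3, h4, rfl⟩ := hR' r' hr'
    obtain ⟨m, rfl⟩ := exists_eq_smul_of_cast_eq_zero m (funext fun v => congrFun hπ (Sum.inl v))
    obtain ⟨y, rfl⟩ := exists_eq_smul_of_cast_eq_zero y (funext fun v => congrFun hπ (Sum.inr v))
    obtain ⟨m', rfl⟩ := exists_eq_smul_of_cast_eq_zero m' (funext fun v => congrFun hπ' (Sum.inl v))
    obtain ⟨y', rfl⟩ := exists_eq_smul_of_cast_eq_zero y' (funext fun v => congrFun hπ' (Sum.inr v))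
    have h := hid h1 h2 h3 h4
    simp only [mulVec_smul, smul_dotProduct, dotProduct_smul, smul_eq_mul] at h
    change (φ ∘ s) ⬝ᵥ Dp *ᵥ (φ ∘ s') = 0
    rw [← hDdot]
    refine (ZMod.intCast_zmod_eq_zero_iff_dvd _ _).2 ?_
    -- With `m` and `y` divisible by `p`, both of their terms carry `p ^ 2` against a single `p` on
    -- the `s` term.
    have hdvd : (p : ℤ) ∣ a * (s ⬝ᵥ D *ᵥ s') := by
      refine ⟨y ⬝ᵥ y' - m ⬝ᵥ (A * Aᵀ) *ᵥ m', mul_left_cancel₀ hp0 ?_⟩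
      linear_combination -h
    exact ((Nat.prime_iff_prime_int.1 Fact.out).dvd_or_dvd hdvd).resolve_left ha
  set G : Matrix (V ⊕ W) (V ⊕ W) (ZMod p) := fromBlocks Mp 0 0 (-1) with hG
  have hGsymm : Gᵀ = G := by simp [hG, fromBlocks_transpose, hMsymm]
  have hB : ∀ x y, toBilin' G x y = toBilin' G y x := by
    intro x y
    rw [toBilin'_apply', toBilin'_apply', dotProduct_mulVec, ← mulVec_transpose, hGsymm,
      dotProduct_comm]
  have hπX : ∀ x ∈ LinearMap.range π, ∃ (s : J ⊕ J → ℤ) (m : V → ℤ) (y : W → ℤ),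
      Aᵀ *ᵥ (gᵀ *ᵥ s + q • m) = q • y ∧ g *ᵥ m = 0 ∧ x = Sum.elim (φ ∘ m) (φ ∘ y) := by
    rintro _ ⟨⟨r, hr⟩, rfl⟩
    obtain ⟨s, m, y, h1, h2, rfl⟩ := hR' r hr
    exact ⟨s, m, y, h1, h2, rfl⟩
  let ζ : (J ⊕ J → ZMod p) →ₗ[ZMod p] (V ⊕ W → ZMod p) := (fromRows gpᵀ 0).mulVecLin
  have hζ : ∀ s, ζ s = Sum.elim (gpᵀ *ᵥ s) 0 := fun s => by
    change fromRows gpᵀ 0 *ᵥ s = _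
    rw [fromRows_mulVec, zero_mulVec]
  have hζinj : Function.Injective ζ := by
    refine (injective_iff_map_eq_zero ζ).2 fun s hs => ?_
    have h0 : gpᵀ *ᵥ s = 0 := by
      ext v
      have := congrFun hs (Sum.inl v)
      rwa [hζ] at this
    refine hDinj s ?_
    rw [← hggp, ← mulVec_mulVec, h0, mulVec_zero]
  have hle := two_mul_finrank_add_le_of_isotropic (toBilin' G) hB (LinearMap.range π)
    (LinearMap.range ζ)
    (by
      intro x hx x' hx'
      obtain ⟨s, m, y, h1, h2, rfl⟩ := hπX x hx
      obtain ⟨s', m', y', h3, h4, rfl⟩ := hπX x' hx'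
      have h := congrArg φ (hid h1 h2 h3 h4)
      rw [RingHom.map_dotProduct, map_add, hMdot, map_mul, map_mul] at h
      rw [toBilin'_apply', hG, fromBlocks_mulVec]
      simp only [Sum.elim_comp_inl, Sum.elim_comp_inr, zero_mulVec, add_zero, zero_add,
        neg_mulVec, one_mulVec, sumElim_dotProduct_sumElim, dotProduct_neg]
      rw [h]
      simp [φ])
    (by
      rintro _ ⟨s, rfl⟩ y
      rw [hB, toBilin'_apply', hζ, hG, fromBlocks_mulVec]
      simp [mulVec_mulVec, hMg])
    (by
      intro x hx hx0
      obtain ⟨s, m, y, h1, h2, rfl⟩ := hπX x hx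
      have h0 : G *ᵥ Sum.elim (φ ∘ m) (φ ∘ y) = 0 := by
        ext i
        have := hx0 (Pi.single i 1)
        rwa [hB, toBilin'_apply', single_one_dotProduct] at this
      rw [hG, fromBlocks_mulVec] at h0
      simp only [Sum.elim_comp_inl, Sum.elim_comp_inr, zero_mulVec, add_zero, zero_add,
        neg_mulVec, one_mulVec] at h0
      have hy : φ ∘ y = 0 := by
        ext w
        have := congrFun h0 (Sum.inr w)
        simpa using this
      -- A radical vector has `y = 0` and `m = gᵀ σ`; then `g m = 0` gives `D σ = 0`, hence `σ = 0`.
      obtain ⟨σ, hσ⟩ := hker (φ ∘ m) (by ext v; exact congrFun h0 (Sum.inl v))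
      have hm : φ ∘ m = gpᵀ *ᵥ σ := hσ
      have hgm : gp *ᵥ (φ ∘ m) = 0 := by
        ext i
        have := RingHom.map_mulVec φ g m i
        rw [h2] at this
        simpa using this.symm
      rw [hm, mulVec_mulVec, hggp] at hgm
      rw [hy, hm, hDinj σ hgm, mulVec_zero]
      ext (i | i) <;> rfl)
  have h1 := LinearMap.finrank_range_add_finrank_ker π
  have h2 := LinearMap.finrank_range_of_inj hψ
  rw [LinearMap.finrank_range_of_inj hζinj] at hle
  simp only [Module.finrank_fintype_fun_eq_card, Fintype.card_sum] at hle hRdim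
  exact even_card_of_isotropic hp4 (φ ∘ c) (fun j => (hcast _).2 (hc j)) (LinearMap.range ψ)
    (by omega) hψiso

/-! ### Cycles of a 2-regular multigraph as periodic walks -/

namespace CovMultigraph

variable {V : Type*}

/-- `F` runs periodically through a cycle of length `n` of `G` whose vertices have no other
edges. -/
structure IsCycleWalk [DecidableEq V] (G : CovMultigraph V) (n : ℕ) (F : ℕ → V) : Prop where
  two_le : 2 ≤ n
  periodic : ∀ k, F (k + n) = F k
  inj : ∀ i < n, ∀ j < n, F i = F j → i = j
  mult_eq : ∀ k y, G.mult (F (k + 1)) y = (if F k = y then 1 else 0) + if F (k + 2) = y then 1 else 0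

theorem val_finRotate {n : ℕ} (i : Fin n) : (finRotate n i : ℕ) = (i + 1) % n := by
  obtain _ | n := n
  · exact i.elim0
  · rw [coe_finRotate]
    split_ifs with h
    · simp [h]
    · have : (i : ℕ) ≠ n := fun h' => h (Fin.ext h')
      rw [Nat.mod_eq_of_lt (by omega)]

theorem finRotate_ne {n : ℕ} (hn : 2 ≤ n) (i : Fin n) : finRotate n i ≠ i := by
  intro h
  have h1 := congrArg Fin.val h
  rw [val_finRotate] at h1
  rcases Nat.lt_or_ge (i + 1) n with h2 | h2
  · rw [Nat.mod_eq_of_lt h2] at h1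
    omega
  · rw [show (i : ℕ) + 1 = n by omega, Nat.mod_self] at h1
    omega

/-- Each edge is counted in its two orientations separately. The two sets of indices are disjoint
even for `n = 2`, where both neighbours coincide and the multiplicity is 2. -/
theorem card_filter_cycle_edges [DecidableEq V] {n : ℕ} (hn : 2 ≤ n) {f : Fin n → V}
    (hf : Function.Injective f) (j : Fin n) (y : V) :
    (Finset.univ.filter fun i : Fin n =>
      s(f i, f (finRotate n i)) = s(f (finRotate n j), y)).card =
      (if f j = y then 1 else 0) + if f (finRotate n (finRotate n j)) = y then 1 else 0 := by
  have h1 : (Finset.univ.filter fun i : Fin n => f i = y ∧ f (finRotate n i) = f (finRotate n j)) =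
      if f j = y then {j} else ∅ := by
    ext i
    rw [Finset.mem_filter, hf.eq_iff, (finRotate n).injective.eq_iff]
    split_ifs with h
    · simp only [Finset.mem_univ, true_and, Finset.mem_singleton]
      exact ⟨fun h' => h'.2, fun h' => ⟨h' ▸ h, h'⟩⟩
    · simp only [Finset.mem_univ, true_and, Finset.notMem_empty, iff_false]
      exact fun h' => h (h'.2 ▸ h'.1)
  have h2 : (Finset.univ.filter fun i : Fin n => f i = f (finRotate n j) ∧ f (finRotate n i) = y) =
      if f (finRotate n (finRotate n j)) = y then {finRotate n j} else ∅ := by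
    ext i
    rw [Finset.mem_filter, hf.eq_iff]
    split_ifs with h
    · simp only [Finset.mem_univ, true_and, Finset.mem_singleton]
      exact ⟨fun h' => h'.1, fun h' => ⟨h', h' ▸ h⟩⟩
    · simp only [Finset.mem_univ, true_and, Finset.notMem_empty, iff_false]
      exact fun h' => h (h'.1 ▸ h'.2)
  have h3 : (Finset.univ.filter fun i : Fin n =>
      s(f i, f (finRotate n i)) = s(f (finRotate n j), y)) =
      (Finset.univ.filter fun i : Fin n => f i = y ∧ f (finRotate n i) = f (finRotate n j)) ∪
      (Finset.univ.filter fun i : Fin n => f i = f (finRotate n j) ∧ f (finRotate n i) = y) := by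
    rw [← Finset.filter_or]
    refine Finset.filter_congr fun i _ => ?_
    rw [Sym2.eq_iff, or_comm]
  rw [h3, Finset.card_union_of_disjoint, h1, h2]
  · congr 1 <;> split_ifs <;> simp
  · rw [Finset.disjoint_filter]
    rintro i - ⟨ha, hb⟩ ⟨hc, hd⟩
    exact finRotate_ne hn i (hf (hd.trans ha.symm))

theorem card_filter_cycle_edges_of_notMem [DecidableEq V] {n : ℕ} {f : Fin n → V} {x : V}
    (hx : x ∉ Set.range f) (y : V) :
    (Finset.univ.filter fun i : Fin n => s(f i, f (finRotate n i)) = s(x, y)).card = 0 := by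
  rw [Finset.card_eq_zero, Finset.filter_eq_empty_iff]
  rintro i - h
  rw [Sym2.eq_iff] at h
  rcases h with h | h
  · exact hx ⟨_, h.1⟩
  · exact hx ⟨_, h.2⟩

namespace IsCycleWalk

variable [DecidableEq V] {G : CovMultigraph V} {n : ℕ} {F : ℕ → V}

theorem periodic_mul (hF : G.IsCycleWalk n F) (k m : ℕ) : F (k + n * m) = F k := by
  induction m with
  | zero => simp
  | succ m ih => rw [Nat.mul_succ, ← Nat.add_assoc, hF.periodic, ih]

theorem apply_mod (hF : G.IsCycleWalk n F) (k : ℕ) : F (k % n) = F k := by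
  conv_rhs => rw [← Nat.mod_add_div k n]
  rw [hF.periodic_mul]

theorem mod_eq (hF : G.IsCycleWalk n F) {i j : ℕ} (h : F i = F j) : i % n = j % n := by
  have hn : 0 < n := by have := hF.two_le; omega
  exact hF.inj _ (Nat.mod_lt _ hn) _ (Nat.mod_lt _ hn) (by rw [hF.apply_mod, hF.apply_mod, h])

theorem exists_eq_succ (hF : G.IsCycleWalk n F) (k : ℕ) : ∃ j, F k = F (j + 1) :=
  ⟨k + n - 1, by
    have := hF.two_le
    rw [show k + n - 1 + 1 = k + n by omega, hF.periodic]⟩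

theorem mem_range_of_mult_ne_zero (hF : G.IsCycleWalk n F) {x y : V} (hx : x ∈ Set.range F)
    (h : G.mult x y ≠ 0) : y ∈ Set.range F := by
  obtain ⟨k, rfl⟩ := hx
  obtain ⟨j, hj⟩ := hF.exists_eq_succ k
  rw [hj, hF.mult_eq] at h
  by_cases h1 : F j = y
  · exact ⟨_, h1⟩
  by_cases h2 : F (j + 2) = y
  · exact ⟨_, h2⟩
  simp [h1, h2] at h

theorem mult_succ_ne_zero (hF : G.IsCycleWalk n F) (k : ℕ) : G.mult (F k) (F (k + 1)) ≠ 0 := by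
  rw [G.symm, hF.mult_eq]
  simp

theorem range_subset (hF : G.IsCycleWalk n F) {n' : ℕ} {F' : ℕ → V} (hF' : G.IsCycleWalk n' F')
    {k : ℕ} (hk : F k ∈ Set.range F') : Set.range F ⊆ Set.range F' := by
  have h : ∀ m, F (k + m) ∈ Set.range F' := by
    intro m
    induction m with
    | zero => exact hk
    | succ m ih => exact hF'.mem_range_of_mult_ne_zero ih (hF.mult_succ_ne_zero _)
  rintro _ ⟨j, rfl⟩
  have hn := hF.two_le
  have h1 : k ≤ n * k := Nat.le_mul_of_pos_left _ (by omega)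
  have := h (j + n * k - k)
  rwa [show k + (j + n * k - k) = j + n * k by omega, hF.periodic_mul] at this

theorem range_eq (hF : G.IsCycleWalk n F) {n' : ℕ} {F' : ℕ → V} (hF' : G.IsCycleWalk n' F')
    {x : V} (hx : x ∈ Set.range F) (hx' : x ∈ Set.range F') : Set.range F = Set.range F' := by
  obtain ⟨k, rfl⟩ := hx
  obtain ⟨k', hk'⟩ := hx'
  exact (hF.range_subset hF' ⟨k', hk'⟩).antisymm (hF'.range_subset hF ⟨k, hk'.symm⟩)

/-- The cycle traversed by a cycle walk, as a subgraph. -/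
theorem exists_isCycle (hF : G.IsCycleWalk n F) :
    ∃ H : CovMultigraph V, H.IsSubgraph G ∧ H.IsCycle n ∧ ∀ y, H.mult (F 0) y = G.mult (F 0) y := by
  classical
  have hn := hF.two_le
  let f : Fin n → V := fun i => F i
  have hf : Function.Injective f := fun i j h => Fin.ext (hF.inj _ i.2 _ j.2 h)
  have hrot : ∀ i, f (finRotate n i) = F (i + 1) := fun i => by
    change F _ = _
    rw [val_finRotate, hF.apply_mod]
  have hrange : ∀ x, x ∈ Set.range F ↔ x ∈ Set.range f := by
    refine fun x => ⟨?_, fun ⟨i, hi⟩ => ⟨i, hi⟩⟩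
    rintro ⟨k, rfl⟩
    exact ⟨⟨k % n, Nat.mod_lt _ (by omega)⟩, hF.apply_mod k⟩
  let H : CovMultigraph V :=
    { mult := fun x y => if x ∈ Set.range F then G.mult x y else 0
      symm := fun x y => by
        by_cases h : G.mult x y = 0
        · simp [h, G.symm y x]
        · have h' : G.mult y x ≠ 0 := by rwa [G.symm]
          have : x ∈ Set.range F ↔ y ∈ Set.range F :=
            ⟨fun hx => hF.mem_range_of_mult_ne_zero hx h,
              fun hy => hF.mem_range_of_mult_ne_zero hy h'⟩
          simp only [this, G.symm x y]
      loopless := fun x => by simp [G.loopless] }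
  refine ⟨H, fun x y => ?_, ⟨hn, f, hf, fun x y => ?_⟩, fun y => if_pos ⟨0, rfl⟩⟩
  · change (if _ then _ else _) ≤ _
    split_ifs <;> simp
  · change (if _ then _ else _) = _
    split_ifs with hx
    · obtain ⟨i, rfl⟩ := (hrange x).1 hx
      obtain ⟨j, rfl⟩ := (finRotate n).surjective i
      rw [card_filter_cycle_edges hn hf, hrot, hF.mult_eq]
      congr 2
      rw [hrot, val_finRotate, ← hF.apply_mod (_ % n + 1), Nat.mod_add_mod, hF.apply_mod]
    · rw [card_filter_cycle_edges_of_notMem (fun h => hx ((hrange x).2 h))]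

end IsCycleWalk

variable [Fintype V] [DecidableEq V] {G : CovMultigraph V}

/-- A cycle already uses degree 2 at each of its vertices, so the inequality of multiplicities is an
equality there. -/
theorem IsSubgraph.exists_isCycleWalk (hG : G.IsRegular 2) {H : CovMultigraph V}
    (hH : H.IsSubgraph G) {n : ℕ} (hn : H.IsCycle n) :
    ∃ F, G.IsCycleWalk n F ∧ (∀ k y, H.mult (F k) y = G.mult (F k) y) ∧
      ∀ x ∉ Set.range F, ∀ y, H.mult x y = 0 := by
  obtain ⟨hn, f, hf, hmult⟩ := hn
  have hpos : 0 < n := by omega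
  let F : ℕ → V := fun k => f ⟨k % n, Nat.mod_lt _ hpos⟩
  have hrot : ∀ k, finRotate n ⟨k % n, Nat.mod_lt _ hpos⟩ = ⟨(k + 1) % n, Nat.mod_lt _ hpos⟩ := by
    intro k
    refine Fin.ext ?_
    rw [val_finRotate]
    simp
  have hHF : ∀ k y, H.mult (F (k + 1)) y =
      (if F k = y then 1 else 0) + if F (k + 2) = y then 1 else 0 := by
    intro k y
    have h := card_filter_cycle_edges hn hf ⟨k % n, Nat.mod_lt _ hpos⟩ y
    rw [hrot, hrot] at h
    rw [hmult]
    exact h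
  have hdeg : ∀ k y, H.mult (F (k + 1)) y = G.mult (F (k + 1)) y := by
    intro k y
    have h1 : ∑ y, H.mult (F (k + 1)) y = ∑ y, G.mult (F (k + 1)) y := by
      rw [show ∑ y, G.mult (F (k + 1)) y = 2 from hG _]
      simp [hHF, Finset.sum_add_distrib]
    exact (Finset.sum_eq_sum_iff_of_le fun y _ => hH _ y).1 h1 y (Finset.mem_univ _)
  have hper : ∀ k, F (k + n) = F k := fun k => by simp [F]
  refine ⟨F, ⟨hn, hper, fun i hi j hj h => ?_, fun k y => by rw [← hdeg, hHF]⟩, fun k y => ?_,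
    fun x hx y => ?_⟩
  · have := congrArg Fin.val (hf h)
    simpa [Nat.mod_eq_of_lt hi, Nat.mod_eq_of_lt hj] using this
  · rw [← hper, show k + n = k + n - 1 + 1 by omega]
    exact hdeg _ _
  · rw [hmult]
    refine card_filter_cycle_edges_of_notMem (fun ⟨i, hi⟩ => hx ⟨i, ?_⟩) y
    rw [← hi]
    simp [F, Nat.mod_eq_of_lt i.2]

/-- Removing one edge from `x` to `u` leaves a single edge, whose other end is `w`. This is the exit
of a walk that entered `x` from `u`. -/
theorem IsRegular.exists_mult_eq (hG : G.IsRegular 2) (x u : V) :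
    ∃ w, G.mult x u ≠ 0 →
      ∀ y, G.mult x y = (if u = y then 1 else 0) + if w = y then 1 else 0 := by
  by_cases hu : G.mult x u = 0
  · exact ⟨u, fun h => absurd hu h⟩
  let m : V → ℕ := fun y => G.mult x y - if u = y then 1 else 0
  have hm : ∀ y, G.mult x y = (if u = y then 1 else 0) + m y := by
    intro y
    simp only [m]
    split_ifs with h
    · subst h; omega
    · omega
  have hsum : ∑ y, m y = 1 := by
    have h : ∑ y, G.mult x y = 2 := hG x
    simp only [hm, Finset.sum_add_distrib] at h
    simp at h
    omega
  obtain ⟨w, hw⟩ : ∃ w, m w ≠ 0 := by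
    by_contra! h
    simp [h] at hsum
  refine ⟨w, fun _ y => ?_⟩
  rw [hm]
  congr 1
  have h1 := Finset.add_sum_erase _ m (Finset.mem_univ w)
  split_ifs with h
  · subst h; omega
  · have h2 : ∑ y ∈ Finset.univ.erase w, m y = 0 := by omega
    exact Finset.sum_eq_zero_iff.1 h2 y (by simp [Ne.symm h])

/-- Every vertex of a `2`-regular multigraph lies on a cycle. -/
theorem IsRegular.exists_isCycleWalk (hG : G.IsRegular 2) (v : V) :
    ∃ n F, G.IsCycleWalk n F ∧ v ∈ Set.range F := by
  choose next hnext using hG.exists_mult_eq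
  obtain ⟨v', hv'⟩ : ∃ v', G.mult v v' ≠ 0 := by
    by_contra! h
    have : ∑ y, G.mult v y = 2 := hG v
    simp [h] at this
  -- The state is a directed edge, so that the walk never returns along the edge just used.
  let h : V × V → V × V := fun d => (d.2, next d.2 d.1)
  let s : ℕ → V := fun k => (h^[k] (v, v')).1
  have hs2 : ∀ k, (h^[k] (v, v')).2 = s (k + 1) := fun k => by
    simp only [s, Function.iterate_succ_apply', h]
  have hsnext : ∀ k, s (k + 2) = next (s (k + 1)) (s k) := fun k => by
    rw [← hs2, Function.iterate_succ_apply']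
    simp only [h, hs2]
    rfl
  have hadj : ∀ k, G.mult (s k) (s (k + 1)) ≠ 0 := by
    intro k
    induction k with
    | zero => exact hv'
    | succ k ih =>
      rw [G.symm] at ih
      rw [hnext _ _ ih, hsnext]
      simp
  have hmult : ∀ k y, G.mult (s (k + 1)) y =
      (if s k = y then 1 else 0) + if s (k + 2) = y then 1 else 0 := by
    intro k y
    rw [hsnext]
    exact hnext _ _ (by rw [G.symm]; exact hadj k) y
  have hex : ∃ n, 0 < n ∧ ∃ i, s i = s (i + n) := by
    obtain ⟨a, b, hab, hne⟩ := Finite.exists_ne_map_eq_of_infinite s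
    rcases Nat.lt_or_gt_of_ne hab with hlt | hlt
    · exact ⟨b - a, by omega, a, by rw [hne]; congr 1; omega⟩
    · exact ⟨a - b, by omega, b, by rw [← hne]; congr 1; omega⟩
  classical
  obtain ⟨hpos, i, hi⟩ := Nat.find_spec hex
  have hmin : ∀ a b, a < b → b < a + Nat.find hex → s a ≠ s b := by
    intro a b hab hb heq
    exact Nat.find_min hex (m := b - a) (by omega)
      ⟨by omega, a, by rw [heq]; congr 1; omega⟩
  set n := Nat.find hex
  have hn : 2 ≤ n := by
    by_contra hlt
    have h1 : n = 1 := by omega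
    rw [h1] at hi
    have := hadj i
    rw [← hi, G.loopless] at this
    exact this rfl
  -- A first return to a vertex must repeat the directed edge: otherwise the edge to `s (i + 1)`
  -- would be the one arrived by, contradicting minimality of `n`, or, for `n = 2`, the multiplicity
  -- count.
  have hi' : s (i + 1) = s (i + n + 1) := by
    have h1 := hmult i (s (i + n))
    have h2 := hmult (i + n - 1) (s (i + 1))
    rw [show i + n - 1 + 1 = i + n by omega, show i + n - 1 + 2 = i + n + 1 by omega, G.symm,
      h1, if_pos hi] at h2
    by_contra hne
    rw [if_neg (Ne.symm hne)] at h2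
    rcases hn.eq_or_lt with h3 | h3
    · rw [← h3] at h2
      simp at h2
    · rw [if_neg (hmin (i + 1) (i + n - 1) (by omega) (by omega)).symm] at h2
      omega
  have hd : h^[i + n] (v, v') = h^[i] (v, v') :=
    Prod.ext hi.symm (by rw [hs2, hs2]; exact hi'.symm)
  have hper : ∀ k, s (i + (k + n)) = s (i + k) := by
    intro k
    simp only [s]
    rw [show i + (k + n) = k + (i + n) by omega, Function.iterate_add_apply, hd,
      ← Function.iterate_add_apply, Nat.add_comm k i]
  have hF : G.IsCycleWalk n (fun k => s (i + k)) := by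
    refine ⟨hn, hper, fun a ha b hb hab => ?_, fun k y => hmult (i + k) y⟩
    by_contra hne
    rcases Nat.lt_or_gt_of_ne hne with hlt | hlt
    · exact hmin (i + a) (i + b) (by omega) (by omega) hab
    · exact hmin (i + b) (i + a) (by omega) (by omega) hab.symm
  refine ⟨n, _, hF, ?_⟩
  -- The repetition might begin only at time `i`; the cycle is closed under adjacency, so going
  -- backwards reaches `v`.
  have hdown : ∀ j ≤ i, s (i - j) ∈ Set.range fun k => s (i + k) := by
    intro j
    induction j with
    | zero => exact fun _ => ⟨0, rfl⟩
    | succ j ih =>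
      intro hj
      refine hF.mem_range_of_mult_ne_zero (ih (by omega)) ?_
      rw [G.symm, show i - j = i - (j + 1) + 1 by omega]
      exact hadj _
  simpa [s] using hdown i le_rfl

end CovMultigraph

/-! ### The kernel of the adjacency matrix -/

namespace CovMultigraph

/-- The sequence `1, 0, -1, 0` of period `4`. -/
def quarterSign (k : ℕ) : ℤ := if k % 4 = 0 then 1 else if k % 4 = 2 then -1 else 0

theorem quarterSign_add_two (k : ℕ) : quarterSign (k + 2) = -quarterSign k := by
  unfold quarterSign
  have : k % 4 < 4 := Nat.mod_lt _ (by norm_num)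
  split_ifs <;> first | rfl | omega

theorem quarterSign_mod {n : ℕ} (hn : 4 ∣ n) (t k : ℕ) :
    quarterSign (k % n + t) = quarterSign (k + t) := by
  unfold quarterSign
  rw [Nat.add_mod, Nat.mod_mod_of_dvd _ hn, ← Nat.add_mod]

theorem quarterSign_mul_add_three (k : ℕ) : quarterSign k * quarterSign (k + 3) = 0 := by
  unfold quarterSign
  split_ifs <;> first | rfl | omega

theorem sum_quarterSign_sq (t m : ℕ) :
    ∑ k ∈ Finset.range (4 * m), quarterSign (k + t) * quarterSign (k + t) = 2 * m := by
  induction m with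
  | zero => simp
  | succ m ih =>
    rw [Nat.mul_succ]
    simp only [Finset.sum_range_succ, ih, Nat.cast_succ]
    have h1 := quarterSign_add_two (4 * m + t)
    have h2 := quarterSign_add_two (4 * m + 1 + t)
    rw [show 4 * m + 2 + t = 4 * m + t + 2 by ring, h1,
      show 4 * m + 3 + t = 4 * m + 1 + t + 2 by ring, h2]
    have h3 : quarterSign (4 * m + t) * quarterSign (4 * m + t) +
        quarterSign (4 * m + 1 + t) * quarterSign (4 * m + 1 + t) = 1 := by
      unfold quarterSign
      split_ifs <;> first | rfl | omega
    linear_combination 2 * h3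

variable {V : Type*} [DecidableEq V] {G : CovMultigraph V} {n : ℕ} {F : ℕ → V}

/-- The vector with entry `quarterSign (k + t)` at the vertex `F k` of a cycle. -/
def cycleVector (n : ℕ) (F : ℕ → V) (t : ℕ) (x : V) : ℤ :=
  ∑ k ∈ Finset.range n, if F k = x then quarterSign (k + t) else 0

theorem cycleVector_of_notMem {x : V} (hx : x ∉ Set.range F) (t : ℕ) :
    cycleVector n F t x = 0 :=
  Finset.sum_eq_zero fun k _ => if_neg fun h => hx ⟨k, h⟩

theorem IsCycleWalk.cycleVector_apply (hF : G.IsCycleWalk n F) (hn : 4 ∣ n) (t k : ℕ) :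
    cycleVector n F t (F k) = quarterSign (k + t) := by
  have hpos : 0 < n := by have := hF.two_le; omega
  rw [cycleVector, Finset.sum_eq_single (k % n), if_pos (hF.apply_mod k), quarterSign_mod hn]
  · intro j hj hne
    refine if_neg fun h => hne ?_
    rw [← hF.mod_eq h, Nat.mod_eq_of_lt (Finset.mem_range.1 hj)]
  · exact fun h => absurd (Finset.mem_range.2 (Nat.mod_lt _ hpos)) h

variable [Fintype V]

theorem sum_cycleVector_mul (n : ℕ) (F : ℕ → V) (t : ℕ) (z : V → ℤ) :
    ∑ x, cycleVector n F t x * z x = ∑ k ∈ Finset.range n, quarterSign (k + t) * z (F k) := by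
  simp only [cycleVector, Finset.sum_mul]
  rw [Finset.sum_comm]
  simp

theorem IsCycleWalk.sum_mult_mul {R : Type*} [CommRing R] (hF : G.IsCycleWalk n F) (k : ℕ)
    (z : V → R) : ∑ y, (G.mult (F (k + 1)) y : R) * z y = z (F k) + z (F (k + 2)) := by
  simp [hF.mult_eq, add_mul, Finset.sum_add_distrib]

theorem IsCycleWalk.sum_mult_mul_cycleVector (hF : G.IsCycleWalk n F) (hn : 4 ∣ n) (t : ℕ)
    (x : V) : ∑ y, (G.mult x y : ℤ) * cycleVector n F t y = 0 := by
  by_cases hx : x ∈ Set.range F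
  · obtain ⟨k, rfl⟩ := hx
    obtain ⟨j, hj⟩ := hF.exists_eq_succ k
    rw [hj, hF.sum_mult_mul, hF.cycleVector_apply hn, hF.cycleVector_apply hn,
      show j + 2 + t = j + t + 2 by ring, quarterSign_add_two, add_neg_cancel]
  · refine Finset.sum_eq_zero fun y _ => ?_
    by_cases hy : y ∈ Set.range F
    · have : G.mult x y = 0 := by
        by_contra h
        rw [G.symm] at h
        exact hx (hF.mem_range_of_mult_ne_zero hy h)
      simp [this]
    · rw [cycleVector_of_notMem hy, mul_zero]

section Kernel

variable {R : Type*} [CommRing R] {z : V → R}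

theorem IsCycleWalk.apply_add_two_of_ker (hF : G.IsCycleWalk n F)
    (hz : ∀ x, ∑ y, (G.mult x y : R) * z y = 0) (k : ℕ) : z (F (k + 2)) = -z (F k) := by
  have := hz (F (k + 1))
  rw [hF.sum_mult_mul] at this
  linear_combination this

theorem IsCycleWalk.apply_add_two_mul_of_ker (hF : G.IsCycleWalk n F)
    (hz : ∀ x, ∑ y, (G.mult x y : R) * z y = 0) (k m : ℕ) :
    z (F (k + 2 * m)) = (-1) ^ m * z (F k) := by
  induction m with
  | zero => simp
  | succ m ih =>
    rw [show k + 2 * (m + 1) = k + 2 * m + 2 by ring, hF.apply_add_two_of_ker hz, ih]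
    ring

theorem IsCycleWalk.eq_zero_of_ker [NoZeroDivisors R] (h2 : (2 : R) ≠ 0)
    (hF : G.IsCycleWalk n F) (hn : ¬ 4 ∣ n) (hz : ∀ x, ∑ y, (G.mult x y : R) * z y = 0) (k : ℕ) :
    z (F k) = 0 := by
  -- Once round an even cycle of length not divisible by 4, or twice round an odd one, is an odd
  -- number of double steps, each changing the sign.
  have key : ∃ m, Odd m ∧ F (k + 2 * m) = F k := by
    rcases Nat.even_or_odd' n with ⟨m, rfl | h⟩
    · refine ⟨m, ?_, hF.periodic k⟩
      rw [← Nat.not_even_iff_odd]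
      rintro ⟨r, rfl⟩
      exact hn ⟨r, by ring⟩
    · refine ⟨n, ⟨m, h⟩, ?_⟩
      rw [mul_comm, hF.periodic_mul]
  obtain ⟨m, hm, hmF⟩ := key
  have h := hF.apply_add_two_mul_of_ker hz k m
  rw [hmF, hm.neg_one_pow] at h
  have : (2 : R) * z (F k) = 0 := by linear_combination h
  exact (mul_eq_zero.1 this).resolve_left h2

theorem IsCycleWalk.apply_eq_of_ker (hF : G.IsCycleWalk n F)
    (hz : ∀ x, ∑ y, (G.mult x y : R) * z y = 0) (k : ℕ) :
    z (F k) = quarterSign k * z (F 0) + quarterSign (k + 3) * z (F 1) := by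
  induction k using Nat.twoStepInduction with
  | zero => simp [quarterSign]
  | one => simp [quarterSign]
  | more k ih _ =>
    rw [hF.apply_add_two_of_ker hz, ih, quarterSign_add_two k, show k + 2 + 3 = k + 3 + 2 by ring,
      quarterSign_add_two (k + 3)]
    push_cast
    ring

end Kernel

/-- Walks along all cycles whose length is divisible by `4`. -/
theorem IsRegular.exists_walks (hG : G.IsRegular 2) :
    ∃ (n : G.cyclesOfLengthDvd 4 → ℕ) (F : G.cyclesOfLengthDvd 4 → ℕ → V),
      (∀ j, G.IsCycleWalk (n j) (F j)) ∧ (∀ j, 4 ∣ n j) ∧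
      (∀ j : G.cyclesOfLengthDvd 4, j.1.IsCycle (n j)) ∧
      (∀ i j x, x ∈ Set.range (F i) → x ∈ Set.range (F j) → i = j) ∧
      ∀ v, (∃ j, v ∈ Set.range (F j)) ∨
        ∃ n' F', G.IsCycleWalk n' F' ∧ ¬ 4 ∣ n' ∧ v ∈ Set.range F' := by
  have h : ∀ j : G.cyclesOfLengthDvd 4, ∃ (n : ℕ) (F : ℕ → V), 4 ∣ n ∧ j.1.IsCycle n ∧
      G.IsCycleWalk n F ∧ (∀ k y, j.1.mult (F k) y = G.mult (F k) y) ∧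
      ∀ x ∉ Set.range F, ∀ y, j.1.mult x y = 0 := by
    rintro ⟨H, hH, n, hn, hc⟩
    obtain ⟨F, hF⟩ := hH.exists_isCycleWalk hG hc
    exact ⟨n, F, hn, hc, hF⟩
  choose n F hn hc hF hmem hnot using h
  refine ⟨n, F, hF, hn, hc, ?_, fun v => ?_⟩
  · intro i j x hi hj
    have hr := (hF i).range_eq (hF j) hi hj
    refine Subtype.ext (CovMultigraph.ext (funext fun x => funext fun y => ?_))
    by_cases hx : x ∈ Set.range (F i)
    · obtain ⟨k, hk⟩ := hx
      obtain ⟨l, hl⟩ : x ∈ Set.range (F j) := hr ▸ ⟨k, hk⟩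
      have h1 := hmem i k y
      have h2 := hmem j l y
      rw [hk] at h1
      rw [hl] at h2
      rw [h1, h2]
    · rw [hnot i x hx, hnot j x (hr ▸ hx)]
  · obtain ⟨m, F', hF', hv⟩ := hG.exists_isCycleWalk v
    by_cases hm : 4 ∣ m
    · left
      obtain ⟨H, hH, hHc, h0⟩ := hF'.exists_isCycle
      refine ⟨⟨H, hH, m, hm, hHc⟩, ?_⟩
      have hF0 : F' 0 ∈ Set.range (F ⟨H, hH, m, hm, hHc⟩) := by
        by_contra hnm
        have h1 := hnot ⟨H, hH, m, hm, hHc⟩ _ hnm (F' 1)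
        exact hF'.mult_succ_ne_zero 0 ((h0 _).symm.trans h1)
      rwa [← hF'.range_eq (hF _) ⟨0, rfl⟩ hF0]
    · exact Or.inr ⟨m, F', hF', hm, hv⟩

/-- The two vectors attached to each cycle of a family. -/
def cycleMatrix {J : Type*} (n : J → ℕ) (F : J → ℕ → V) : Matrix (J ⊕ J) V ℤ :=
  Matrix.of (Sum.elim (fun j => cycleVector (n j) (F j) 0) (fun j => cycleVector (n j) (F j) 3))

section Family

variable {J : Type*} {n : J → ℕ} {F : J → ℕ → V}

theorem sum_mult_mul_cycleMatrix (hF : ∀ j, G.IsCycleWalk (n j) (F j)) (hn : ∀ j, 4 ∣ n j) (i : J ⊕ J) (x : V) :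
    ∑ y, (G.mult x y : ℤ) * cycleMatrix n F i y = 0 := by
  rcases i with j | j <;> exact (hF j).sum_mult_mul_cycleVector (hn j) _ x

/-- The shifts 0 and 3 give the real and imaginary parts of `i ^ k`: their supports on a cycle are
disjoint, and each has `n / 2` entries equal to `±1`. -/
theorem cycleMatrix_mul_transpose [DecidableEq J] (hF : ∀ j, G.IsCycleWalk (n j) (F j))
    (hn : ∀ j, 4 ∣ n j) (hdisj : ∀ i j x, x ∈ Set.range (F i) → x ∈ Set.range (F j) → i = j) :
    cycleMatrix n F * (cycleMatrix n F)ᵀ =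
      diagonal (Sum.elim (fun j => ((n j / 2 : ℕ) : ℤ)) (fun j => ((n j / 2 : ℕ) : ℤ))) := by
  have hne : ∀ i j t t', i ≠ j →
      ∑ x, cycleVector (n i) (F i) t x * cycleVector (n j) (F j) t' x = 0 := by
    intro i j t t' hij
    rw [sum_cycleVector_mul]
    refine Finset.sum_eq_zero fun k _ => ?_
    rw [cycleVector_of_notMem fun h => hij (hdisj i j _ ⟨k, rfl⟩ h), mul_zero]
  have heq : ∀ j t t', ∑ x, cycleVector (n j) (F j) t x * cycleVector (n j) (F j) t' x =
      ∑ k ∈ Finset.range (n j), quarterSign (k + t) * quarterSign (k + t') := by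
    intro j t t'
    rw [sum_cycleVector_mul]
    simp only [(hF j).cycleVector_apply (hn j)]
  have hsq : ∀ j t, ∑ k ∈ Finset.range (n j), quarterSign (k + t) * quarterSign (k + t) =
      ((n j / 2 : ℕ) : ℤ) := by
    intro j t
    obtain ⟨m, hm⟩ := hn j
    rw [hm, sum_quarterSign_sq, show 4 * m / 2 = 2 * m by omega]
    push_cast
    ring
  have hz : ∀ j, ∑ k ∈ Finset.range (n j), quarterSign (k + 0) * quarterSign (k + 3) = 0 :=
    fun j => Finset.sum_eq_zero fun k _ => quarterSign_mul_add_three k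
  ext (i | i) (j | j) <;> rw [Matrix.mul_apply] <;>
    simp only [cycleMatrix, transpose_apply, Matrix.of_apply, Sum.elim_inl, Sum.elim_inr]
  · by_cases h : i = j
    · subst h; rw [heq, hsq, diagonal_apply_eq]; rfl
    · rw [hne _ _ _ _ h, diagonal_apply_ne _ (by simpa using h)]
  · rw [diagonal_apply_ne _ (by simp)]
    by_cases h : i = j
    · subst h; rw [heq, hz]
    · rw [hne _ _ _ _ h]
  · rw [diagonal_apply_ne _ (by simp)]
    by_cases h : i = j
    · subst h; rw [heq]; simp only [mul_comm (quarterSign (_ + 3))]; exact hz _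
    · rw [hne _ _ _ _ h]
  · by_cases h : i = j
    · subst h; rw [heq, hsq, diagonal_apply_eq]; rfl
    · rw [hne _ _ _ _ h, diagonal_apply_ne _ (by simpa using h)]

/-- A kernel vector is determined on each cycle of the family by its values at the first two
vertices, which serve as coefficients, and vanishes on all other cycles. -/
theorem exists_eq_cycleMatrix_mulVec_of_ker [Fintype J] {R : Type*} [CommRing R]
    [NoZeroDivisors R] (hF : ∀ j, G.IsCycleWalk (n j) (F j)) (hn : ∀ j, 4 ∣ n j)
    (hdisj : ∀ i j x, x ∈ Set.range (F i) → x ∈ Set.range (F j) → i = j)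
    (h2 : (2 : R) ≠ 0) (hcov : ∀ v, (∃ j, v ∈ Set.range (F j)) ∨
      ∃ n' F', G.IsCycleWalk n' F' ∧ ¬ 4 ∣ n' ∧ v ∈ Set.range F')
    {z : V → R} (hz : ∀ x, ∑ y, (G.mult x y : R) * z y = 0) :
    ∃ s : J ⊕ J → R, z = ((cycleMatrix n F).map (Int.cast : ℤ → R))ᵀ *ᵥ s := by
  refine ⟨Sum.elim (fun j => z (F j 0)) (fun j => z (F j 1)), funext fun v => ?_⟩
  simp only [mulVec, dotProduct, transpose_apply, Matrix.map_apply, cycleMatrix, Matrix.of_apply,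
    Fintype.sum_sum_type, Sum.elim_inl, Sum.elim_inr]
  rw [← Finset.sum_add_distrib]
  by_cases hv : ∃ j, v ∈ Set.range (F j)
  · obtain ⟨j, k, rfl⟩ := hv
    rw [Finset.sum_eq_single j, (hF j).cycleVector_apply (hn j), (hF j).cycleVector_apply (hn j)]
    · exact (hF j).apply_eq_of_ker hz k
    · intro i _ hij
      have : F j k ∉ Set.range (F i) := fun h => hij (hdisj i j _ h ⟨k, rfl⟩)
      simp [cycleVector_of_notMem this]
    · simp
  · obtain ⟨n', F', hF', hn', k, rfl⟩ := (hcov v).resolve_left hv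
    rw [hF'.eq_zero_of_ker h2 hn' hz, Finset.sum_eq_zero]
    intro i _
    have : F' k ∉ Set.range (F i) := fun h => hv ⟨i, h⟩
    simp [cycleVector_of_notMem this]

end Family

end CovMultigraph

/-! ### Counting identities for coverings -/

namespace CovMultigraph

variable {V : Type*} [Fintype V] {G : CovMultigraph V}

theorem IsRegular.sum_sum_mult_mul {R : Type*} [CommRing R] {m : ℕ} (hG : G.IsRegular m)
    (z : V → R) : ∑ x, ∑ y, (G.mult x y : R) * z y = m * ∑ y, z y := by
  rw [Finset.sum_comm, Finset.mul_sum]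
  refine Finset.sum_congr rfl fun y _ => ?_
  rw [← Finset.sum_mul]
  congr 1
  rw [← hG y, degree, Nat.cast_sum]
  exact Finset.sum_congr rfl fun x _ => by rw [G.symm]

end CovMultigraph

namespace PairCovering

variable {V : Type*} [Fintype V] [DecidableEq V] {v k lam : ℕ}

/-- The incidence matrix of an indexed family of blocks. -/
def incidence {W : Type*} (B : W → Finset V) : Matrix V W ℤ :=
  Matrix.of fun x w => if x ∈ B w then 1 else 0

theorem exists_index.{u} {V : Type u} [Fintype V] [DecidableEq V] {v k lam : ℕ}
    (C : PairCovering V v k lam) :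
    ∃ (W : Type u) (_ : Fintype W) (B : W → Finset V), Fintype.card W = C.blocks.card ∧
      (∀ w, B w ∈ C.blocks) ∧
      ∀ x y, (incidence B * (incidence B)ᵀ) x y = C.pairCount x y := by
  refine ⟨C.blocks, inferInstance, fun w => w.1, Multiset.card_coe _,
    fun w => Multiset.coe_mem, fun x y => ?_⟩
  have h : C.pairCount x y =
      (Finset.univ.filter fun w : C.blocks => x ∈ w.1 ∧ y ∈ w.1).card := by
    unfold pairCount
    conv_lhs => rw [← Multiset.map_univ_coe C.blocks]
    rw [Multiset.countP_map]
    rfl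
  rw [h, Matrix.mul_apply, Finset.card_filter, Nat.cast_sum]
  refine Finset.sum_congr rfl fun w _ => ?_
  simp only [incidence, Matrix.of_apply, transpose_apply]
  by_cases h1 : x ∈ w.1 <;> by_cases h2 : y ∈ w.1 <;> simp [h1, h2]

theorem pairCount_of_ne (C : PairCovering V v k lam) {x y : V} (h : x ≠ y) :
    C.pairCount x y = lam + C.excess.mult x y := by
  have := C.covers x y h
  simp only [excess, if_neg h, pairCount]
  omega

theorem sum_pairCount (C : PairCovering V v k lam) (x : V) :
    ∑ y, C.pairCount x y = k * C.pairCount x x := by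
  obtain ⟨W, _, B, -, hB, hM⟩ := C.exists_index
  have h : ∑ y, (C.pairCount x y : ℤ) = k * C.pairCount x x := by
    simp only [← hM, Matrix.mul_apply]
    rw [Finset.sum_comm, Finset.mul_sum]
    refine Finset.sum_congr rfl fun w _ => ?_
    have hk : ∑ y, (incidence B)ᵀ w y = (k : ℤ) := by
      simp [incidence, C.card_block _ (hB w)]
    rw [← Finset.mul_sum, hk]
    simp only [incidence, Matrix.of_apply, transpose_apply]
    split_ifs <;> simp
  exact_mod_cast h

/-- In a covering with `m`-regular excess, every point lies in the same number of blocks. -/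
theorem pairCount_self (C : PairCovering V v k lam) {m : ℕ} (hk : 1 < k)
    (hreg : C.excess.IsRegular m) (hv : (lam : ℤ) * (v - 1) = k * (k - 1) - m) (x : V) :
    C.pairCount x x = k := by
  have h1 := C.sum_pairCount x
  have h2 : ∑ y, (C.excess.mult x y + lam : ℤ) = m + v * lam := by
    rw [Finset.sum_add_distrib, Finset.sum_const, Finset.card_univ, C.card_points]
    have := hreg x
    rw [CovMultigraph.degree] at this
    rw [← this]
    simp
  have h3 : ∑ y, (C.pairCount x y : ℤ) = k * C.pairCount x x := by exact_mod_cast h1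
  rw [← Finset.add_sum_erase _ _ (Finset.mem_univ x)] at h2 h3
  have h4 : ∑ y ∈ Finset.univ.erase x, (C.pairCount x y : ℤ) =
      ∑ y ∈ Finset.univ.erase x, (C.excess.mult x y + lam : ℤ) := by
    refine Finset.sum_congr rfl fun y hy => ?_
    rw [C.pairCount_of_ne (Finset.ne_of_mem_erase hy).symm]
    push_cast
    ring
  rw [C.excess.loopless] at h2
  push_cast at h2
  -- Pairs of a block through `x` and another point of it, counted in two ways.
  have h5 : ((k : ℤ) - 1) * C.pairCount x x = (k - 1) * k := by
    linear_combination -h3 + h4 + h2 + hv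
  have hk' : (k : ℤ) - 1 ≠ 0 := by omega
  exact_mod_cast mul_left_cancel₀ hk' h5

theorem sum_pairCount_mul (C : PairCovering V v k lam) (hr : ∀ x, C.pairCount x x = k)
    {R : Type*} [CommRing R] (x : V) (z : V → R) :
    ∑ y, (C.pairCount x y : R) * z y =
      (k - lam) * z x + lam * ∑ y, z y + ∑ y, (C.excess.mult x y : R) * z y := by
  have h : ∀ y, (C.pairCount x y : R) * z y =
      (if x = y then (k - lam : R) * z y else 0) + lam * z y + (C.excess.mult x y : R) * z y := by
    intro y
    by_cases hxy : x = y
    · subst hxy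
      rw [hr, C.excess.loopless, if_pos rfl]
      push_cast
      ring
    · rw [C.pairCount_of_ne hxy, if_neg hxy]
      push_cast
      ring
  simp only [h, Finset.sum_add_distrib, ← Finset.mul_sum]
  simp

end PairCovering

/-! ### The nonexistence theorem -/

theorem mainTheorem1 (v k lam p : ℕ) (hlam : 0 < lam) (hk : lam + 2 < k)
    (hv : (v : ℚ) = ((k : ℚ) * ((k : ℚ) - 1) - 2) / (lam : ℚ) + 1)
    (hp : p.Prime) (hp4 : p ≡ 3 [MOD 4]) (hplam : ¬ p ∣ lam)
    (hodd : Odd ((k - lam).factorization p))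
    {V : Type*} [Fintype V] [DecidableEq V] :
    ¬ ∃ C : PairCovering V v k lam,
      C.IsSymmetric ∧
      C.excess.IsRegular 2 ∧
      Odd (C.excess.cyclesOfLengthDvd 4).ncard ∧
      C.excess.cyclesOfLengthDvd (2 * p) = ∅ := by
  classical
  rintro ⟨C, hsymm, hreg, hcyc, hempty⟩
  have : Fact p.Prime := ⟨hp⟩
  have hp4' : p % 4 = 3 := hp4
  have hv' : (lam : ℤ) * (v - 1) = k * (k - 1) - 2 := by
    have hl : (lam : ℚ) ≠ 0 := by exact_mod_cast hlam.ne'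
    have h : (lam : ℚ) * (v - 1) = k * (k - 1) - 2 := by
      rw [hv]
      field_simp
      ring
    exact_mod_cast h
  have hr := C.pairCount_self (by omega) hreg hv'
  have : Finite (C.excess.cyclesOfLengthDvd 4) := Set.finite_of_ncard_pos hcyc.pos
  have : Fintype (C.excess.cyclesOfLengthDvd 4) := Fintype.ofFinite _
  obtain ⟨n, F, hF, hn, hc, hdisj, hcov⟩ := hreg.exists_walks
  obtain ⟨W, _, B, hW, -, hM⟩ := C.exists_index
  obtain ⟨f, hf⟩ := hodd
  have ha0 : k - lam ≠ 0 := by omega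
  have hfac : (k : ℤ) - lam = (p : ℤ) ^ (2 * f + 1) * ((k - lam) / p ^ (2 * f + 1) : ℕ) := by
    have h := Nat.ordProj_mul_ordCompl_eq_self (k - lam) p
    rw [hf] at h
    rw [← Nat.cast_sub (by omega)]
    exact_mod_cast h.symm
  have hpk : ((k : ZMod p) - lam) = 0 := by
    have h := congrArg (Int.cast : ℤ → ZMod p) hfac
    push_cast at h
    rw [h, CharP.cast_eq_zero, zero_pow (by omega), zero_mul]
  have heven := even_card_of_gram hp4' (hW.trans (hsymm.trans C.card_points.symm))
    (PairCovering.incidence B) f ((k - lam) / p ^ (2 * f + 1) : ℕ)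
    (by
      have h := Nat.not_dvd_ordCompl hp ha0
      rw [hf] at h
      exact_mod_cast h)
    (fun j => ((n j / 2 : ℕ) : ℤ))
    (by
      intro j h
      obtain ⟨r, hr⟩ := Int.natCast_dvd_natCast.1 h
      obtain ⟨m, hm⟩ := hn j
      -- If `p` divided `n j / 2`, then `2p` would divide the even number `n j`.
      have hmem : j.1 ∈ C.excess.cyclesOfLengthDvd (2 * p) := by
        refine ⟨j.2.1, n j, ⟨r, ?_⟩, hc j⟩
        rw [mul_assoc, ← hr]
        omega
      rw [hempty] at hmem
      exact hmem)
    (CovMultigraph.cycleMatrix n F) (CovMultigraph.cycleMatrix_mul_transpose hF hn hdisj)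
    (by
      rw [← hfac]
      ext x i
      rw [Matrix.mul_apply]
      simp only [hM, transpose_apply, Matrix.smul_apply, smul_eq_mul]
      have hE := CovMultigraph.sum_mult_mul_cycleMatrix hF hn i
      have hsum := hreg.sum_sum_mult_mul (CovMultigraph.cycleMatrix n F i)
      simp only [hE, Finset.sum_const_zero] at hsum
      have hsum0 : ∑ y, CovMultigraph.cycleMatrix n F i y = 0 := by
        push_cast at hsum
        omega
      have h := C.sum_pairCount_mul hr x (CovMultigraph.cycleMatrix n F i)
      rw [hE, hsum0] at h
      rw [h]
      ring)
    (by
      intro z hz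
      have hz' : ∀ x, (lam : ZMod p) * ∑ y, z y + ∑ y, (C.excess.mult x y : ZMod p) * z y = 0 := by
        intro x
        have h1 := congrFun hz x
        simp only [mulVec, dotProduct, Matrix.map_apply, hM, Int.cast_natCast] at h1
        rw [C.sum_pairCount_mul hr, hpk, zero_mul, zero_add] at h1
        exact h1
      -- Summing over `x` gives the factor `lam * v + 2 = k ^ 2 - k + lam`, which is `k ^ 2` modulo
      -- `p`. As `k ≡ lam` is a unit, the coordinate sum vanishes and only `E z = 0` remains.
      have hsum : (k : ZMod p) * k * ∑ y, z y = 0 := by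
        have h1 := Finset.sum_congr rfl fun x (_ : x ∈ Finset.univ) => hz' x
        rw [Finset.sum_add_distrib, hreg.sum_sum_mult_mul, Finset.sum_const, Finset.sum_const_zero,
          Finset.card_univ, C.card_points, nsmul_eq_mul] at h1
        have h2 := congrArg (Int.cast : ℤ → ZMod p) hv'
        push_cast at h1 h2
        linear_combination h1 - (∑ y, z y) * h2 + (∑ y, z y) * hpk
      have hk0 : (k : ZMod p) ≠ 0 := by
        rw [sub_eq_zero.1 hpk, ne_eq, ZMod.natCast_eq_zero_iff]
        exact hplam
      have hsum0 := (mul_eq_zero.1 hsum).resolve_left (mul_ne_zero hk0 hk0)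
      have h2 : (2 : ZMod p) ≠ 0 := by
        intro h
        have : ((2 : ℕ) : ZMod p) = 0 := by exact_mod_cast h
        rw [ZMod.natCast_eq_zero_iff] at this
        have := Nat.le_of_dvd (by norm_num) this
        omega
      refine CovMultigraph.exists_eq_cycleMatrix_mulVec_of_ker hF hn hdisj h2 hcov fun x => ?_
      have := hz' x
      rwa [hsum0, mul_zero, zero_add] at this)
  rw [← Nat.card_eq_fintype_card, Nat.card_coe_set_eq] at heven
  exact Nat.not_even_iff_odd.2 hcyc heven
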